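/- Let $\mathbb{Z}^2$ denote the square lattice, i.e. the Cayley graph of $\mathbb{Z}^2$ with respect to the generators $(1,0),(0,1)$, with edge set $E$. Identify subgraphs of $\mathbb{Z}^2$ (sets of open edges) with elements of $\{0,1\}^{E}\cong(\mathbb{Z}/2\mathbb{Z})^{E}$, equipped with the product topology and Borel $\sigma$-algebra. A subgraph is even (respectively, odd) if every vertex of $\mathbb{Z}^2$ is incident to an even (respectively, odd) number of its edges. The even subgraphs form a compact subgroup of $(\mathbb{Z}/2\mathbb{Z})^{E}$; the uniform even subgraph is the random subgraph distributed according to the Haar probability measure on this subgroup. The uniform odd subgraph $\mathrm{UOG}$ of $\mathbb{Z}^2$ is the symmetric difference of a fixed odd subgraph $\omega_0$ of $\mathbb{Z}^2$ and the uniform even subgraph (such an $\omega_0$ exists, and the law does not depend on its choice). Then, almost surely, the uniform odd subgraph of $\mathbb{Z}^2$ has only finitely many infinite clusters (infinite connected components). -/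

import Mathlib

open MeasureTheory

namespace OddSubgraph

/-- The square lattice `ℤ²`: the Cayley graph of `ℤ × ℤ` with respect to the generators
`(1, 0)` and `(0, 1)`. -/
def squareLattice : SimpleGraph (ℤ × ℤ) :=
  SimpleGraph.addCayley {((1 : ℤ), (0 : ℤ)), ((0 : ℤ), (1 : ℤ))}

/-- Edge configurations `{0,1}^{E(ℤ²)}`, identified with `(ℤ/2ℤ)^{E(ℤ²)}`.  The value `1` means
that the edge is open (present), the value `0` that it is closed (absent); addition is symmetric
difference.  The topology and the σ-algebra are the product ones. -/
abbrev Config : Type := squareLattice.edgeSet → ZMod 2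

/-- The spanning subgraph of `ℤ²` formed by the open edges of `ω`. -/
def openGraph (ω : Config) : SimpleGraph (ℤ × ℤ) where
  Adj u v := ∃ h : squareLattice.Adj u v, ω ⟨s(u, v), h⟩ = 1
  symm := ⟨by
    rintro u v ⟨h, hω⟩
    refine ⟨h.symm, ?_⟩
    have e : (⟨s(v, u), h.symm⟩ : squareLattice.edgeSet) = ⟨s(u, v), h⟩ :=
      Subtype.ext Sym2.eq_swap
    exact (congrArg ω e).trans hω⟩
  loopless := ⟨fun u h => squareLattice.loopless.irrefl u h.1⟩

/-- Every vertex is incident to an even number of open edges. -/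
def IsEven (ω : Config) : Prop := ∀ v, Even ((openGraph ω).neighborSet v).ncard

/-- Every vertex is incident to an odd number of open edges. -/
def IsOdd (ω : Config) : Prop := ∀ v, Odd ((openGraph ω).neighborSet v).ncard

/-- The infinite clusters of `ω`: the infinite connected components of its open subgraph. -/
def infiniteClusters (ω : Config) : Set (openGraph ω).ConnectedComponent :=
  {C | C.supp.Infinite}

/-- The four lattice neighbours of a vertex. -/
def nbrs (v : ℤ × ℤ) : Finset (ℤ × ℤ) :=
  {v + (1, 0), v - (1, 0), v + (0, 1), v - (0, 1)}

theorem adj_iff_mem_nbrs (v w : ℤ × ℤ) : squareLattice.Adj v w ↔ w ∈ nbrs v := by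
  obtain ⟨a, b⟩ := v
  obtain ⟨c, d⟩ := w
  simp only [squareLattice, SimpleGraph.addCayley_adj', nbrs, Finset.mem_insert,
    Finset.mem_singleton, Set.mem_insert_iff, Set.mem_singleton_iff, exists_eq_or_imp,
    exists_eq_left, Prod.mk_add_mk, Prod.mk_sub_mk, Prod.mk.injEq, ne_eq]
  omega

open Classical in
/-- The state of the edge between `v` and `w` (and `0` if there is no such edge). -/
noncomputable def val (ω : Config) (v w : ℤ × ℤ) : ZMod 2 :=
  if h : squareLattice.Adj v w then ω ⟨s(v, w), h⟩ else 0

theorem openGraph_adj_iff (ω : Config) (v w : ℤ × ℤ) :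
    (openGraph ω).Adj v w ↔ val ω v w = 1 := by
  unfold val
  constructor
  · rintro ⟨h, hω⟩
    rw [dif_pos h, hω]
  · intro h
    split_ifs at h with hA
    · exact ⟨hA, h⟩
    · exact absurd h (by decide)

theorem val_add (ω η : Config) (v w : ℤ × ℤ) : val (ω + η) v w = val ω v w + val η v w := by
  unfold val
  split_ifs <;> simp

theorem continuous_val (v w : ℤ × ℤ) : Continuous fun ω : Config => val ω v w := by
  unfold val
  split_ifs with h
  · exact continuous_apply _
  · exact continuous_const

theorem ncard_cast (ω : Config) (v : ℤ × ℤ) :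
    ((((openGraph ω).neighborSet v).ncard : ℕ) : ZMod 2) = ∑ w ∈ nbrs v, val ω v w := by
  have e : (openGraph ω).neighborSet v = ↑((nbrs v).filter fun w => val ω v w = 1) := by
    ext w
    simp only [SimpleGraph.mem_neighborSet, Finset.coe_filter, Set.mem_ofPred_eq,
      openGraph_adj_iff]
    refine ⟨fun h => ⟨?_, h⟩, fun h => h.2⟩
    rw [← adj_iff_mem_nbrs]
    exact ((openGraph_adj_iff ω v w).2 h).1
  have key : ∀ x : ZMod 2, (if x = 1 then (1 : ZMod 2) else 0) = x := by decide
  rw [e, Set.ncard_coe_finset, Finset.card_filter, Nat.cast_sum]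
  refine Finset.sum_congr rfl fun w _ => ?_
  simpa using key (val ω v w)

theorem isEven_iff (ω : Config) : IsEven ω ↔ ∀ v, ∑ w ∈ nbrs v, val ω v w = 0 := by
  refine forall_congr' fun v => ?_
  rw [← ncard_cast, ZMod.natCast_eq_zero_iff_even]

theorem isOdd_iff (ω : Config) : IsOdd ω ↔ ∀ v, ∑ w ∈ nbrs v, val ω v w = 1 := by
  refine forall_congr' fun v => ?_
  rw [← ncard_cast, ZMod.natCast_eq_one_iff_odd]

theorem IsEven.add {ω η : Config} (hω : IsEven ω) (hη : IsEven η) : IsEven (ω + η) := by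
  rw [isEven_iff] at *
  intro v
  simp [val_add, Finset.sum_add_distrib, hω v, hη v]

/-- The even subgraphs of `ℤ²`, as a subgroup of `(ℤ/2ℤ)^{E(ℤ²)}`. -/
def evenSubgraphs : AddSubgroup Config where
  carrier := {ω | IsEven ω}
  add_mem' := IsEven.add
  zero_mem' := by
    simp only [Set.mem_ofPred_eq, isEven_iff]
    intro v
    simp [val]
  neg_mem' := by
    intro ω hω
    have e : -ω = ω := funext fun _ => ZModModule.neg_eq_self _
    rwa [e]

theorem isClosed_evenSubgraphs : IsClosed (evenSubgraphs : Set Config) := by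
  have e : (evenSubgraphs : Set Config) = ⋂ v, {ω | ∑ w ∈ nbrs v, val ω v w = 0} := by
    ext ω
    rw [Set.mem_iInter]
    exact isEven_iff ω
  rw [e]
  exact isClosed_iInter fun v =>
    isClosed_eq (continuous_finsetSum _ fun w _ => continuous_val v w) continuous_const

instance instCompactSpaceEvenSubgraphs : CompactSpace evenSubgraphs :=
  isCompact_iff_compactSpace.mp isClosed_evenSubgraphs.isCompact

/-- The uniform even subgraph of `ℤ²`: the Haar probability measure on the compact group of even
subgraphs. -/
noncomputable def uniformEven : Measure evenSubgraphs := Measure.addHaarMeasure ⊤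

instance instIsProbabilityMeasureUniformEven : IsProbabilityMeasure uniformEven :=
  ⟨Measure.addHaarMeasure_self (K₀ := (⊤ : TopologicalSpace.PositiveCompacts evenSubgraphs))⟩

/-- The uniform odd subgraph of `ℤ²`: the law of the symmetric difference of a fixed odd
subgraph `ω₀` and a uniform even subgraph. -/
noncomputable def uniformOdd (ω₀ : Config) : Measure Config :=
  uniformEven.map fun η : evenSubgraphs => ω₀ + (η : Config)

/-- The law of the uniform odd subgraph does not depend on the reference odd subgraph. -/
theorem uniformOdd_eq {ω₀ ω₁ : Config} (h₀ : IsOdd ω₀) (h₁ : IsOdd ω₁) :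
    uniformOdd ω₀ = uniformOdd ω₁ := by
  have hδ : IsEven (ω₁ + ω₀) := by
    rw [isOdd_iff] at h₀ h₁
    rw [isEven_iff]
    intro v
    simp only [val_add, Finset.sum_add_distrib, h₀ v, h₁ v]
    decide
  let δ : evenSubgraphs := ⟨ω₁ + ω₀, hδ⟩
  have hm : uniformEven.map (fun η => δ + η) = uniformEven := by
    unfold uniformEven
    exact map_add_left_eq_self _ δ
  have hf : Measurable fun η : evenSubgraphs => ω₁ + (η : Config) :=
    (measurable_const_add ω₁).comp measurable_subtype_coe
  have e : (fun η : evenSubgraphs => ω₀ + (η : Config)) =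
      (fun η : evenSubgraphs => ω₁ + (η : Config)) ∘ fun η => δ + η := by
    funext η
    have h2 : ω₁ + ω₁ = 0 := funext fun _ => ZModModule.add_self _
    simp only [Function.comp, δ, AddSubgroup.coe_add, ← add_assoc, h2, zero_add]
  conv_rhs => rw [uniformOdd, ← hm, Measure.map_map hf (measurable_const_add δ), ← e]
  rfl

/-- The square lattice has odd subgraphs: the perfect matching formed by the edges from `(2k, y)`
to `(2k + 1, y)` is one. -/
theorem exists_isOdd : ∃ ω₀ : Config, IsOdd ω₀ := by
  classical
  let P : ℤ × ℤ → ℤ × ℤ → Prop := fun u v =>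
    u.2 = v.2 ∧ (u.1 % 2 = 0 ∧ v.1 = u.1 + 1 ∨ v.1 % 2 = 0 ∧ u.1 = v.1 + 1)
  have hP : ∀ u v, P u v ↔ P v u := by
    intro u v
    simp only [P]
    omega
  let ω₀ : Config := fun e =>
    if Sym2.lift ⟨P, fun u v => propext (hP u v)⟩ e.1 then 1 else 0
  refine ⟨ω₀, fun v => ?_⟩
  have hadj : ∀ w, (openGraph ω₀).Adj v w ↔ P v w := by
    intro w
    constructor
    · rintro ⟨h, hω⟩
      by_contra hc
      simp [ω₀, hc] at hω
    · intro h
      have hA : squareLattice.Adj v w := by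
        rw [adj_iff_mem_nbrs]
        obtain ⟨a, b⟩ := v
        obtain ⟨c, d⟩ := w
        simp only [P] at h
        simp only [nbrs, Finset.mem_insert, Finset.mem_singleton, Prod.mk_add_mk,
          Prod.mk_sub_mk, Prod.mk.injEq]
        omega
      exact ⟨hA, by simp [ω₀, h]⟩
  have e : (openGraph ω₀).neighborSet v =
      {(if v.1 % 2 = 0 then v.1 + 1 else v.1 - 1, v.2)} := by
    ext w
    obtain ⟨a, b⟩ := v
    obtain ⟨c, d⟩ := w
    simp only [SimpleGraph.mem_neighborSet, hadj, P, Set.mem_singleton_iff, Prod.mk.injEq]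
    split_ifs <;> omega
  rw [e, Set.ncard_singleton]
  exact odd_one

end OddSubgraph

namespace OddSubgraph

/-! This is a Burton–Keane argument in which finite energy is replaced by adding finite even
subgraphs. The law is invariant under lattice automorphisms (`measurePreserving_pull`) and under
adding any fixed even subgraph (`measurePreserving_add`), in particular the boundary of a finite set
of faces.

Suppose there are infinitely many infinite clusters. A large square meets 25 of them, and each must
meet one of the four lines around it, so some line, up to reflection a row, meets seven
(`exists_crowded_line`). Parity forbids opening every edge of a box, but flipping faces can open a
thin path through the relevant segment of the row, the bracket. All but at most four vertices from
which the surrounding strip can be left lie on the bracket, so three of the seven clusters leave the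
strip through the bracket only. It becomes a trifurcation: a connected set whose deletion leaves
three distinct infinite components adjacent to it (`exists_toggle`). Since finite sets of faces are
countable in number, some bracket would be a trifurcation with positive probability.

This is impossible (`measure_trifurcation_eq_zero`): of `M ^ 2` disjoint translates of the bracket
in a box of side of order `M`, an expected number proportional to `M ^ 2` would be trifurcations,
whereas `card_branching_le` bounds their number by the size of the boundary, of order `M`. -/

/-- The graph obtained from `G` by keeping only the edges between vertices of `A`. -/
def restrict {V : Type*} (G : SimpleGraph V) (A : Set V) : SimpleGraph V where
  Adj x y := G.Adj x y ∧ x ∈ A ∧ y ∈ A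
  symm := ⟨fun _ _ h => ⟨h.1.symm, h.2.2, h.2.1⟩⟩
  loopless := ⟨fun x h => G.loopless.irrefl x h.1⟩

/-- Any two vertices of `A` are joined by a path of `G` inside `A`. -/
def Linked {V : Type*} (G : SimpleGraph V) (A : Set V) : Prop :=
  ∀ x ∈ A, ∀ y ∈ A, (restrict G A).Reachable x y

/-! ### Connected sets, branches and the combinatorial bound on trifurcations -/

section Graph

variable {V : Type*} {G : SimpleGraph V}

theorem restrict_mono {A B : Set V} (h : A ⊆ B) : restrict G A ≤ restrict G B :=
  fun _ _ hxy => ⟨hxy.1, h hxy.2.1, h hxy.2.2⟩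

theorem mem_of_reachable {Z : Set V} (hZ : ∀ x ∈ Z, ∀ y, G.Adj x y → y ∈ Z) {x y : V}
    (h : G.Reachable x y) (hx : x ∈ Z) : y ∈ Z := by
  obtain ⟨p⟩ := h
  induction p with
  | nil => exact hx
  | cons hadj _ ih => exact ih (hZ _ hx _ hadj)

theorem Linked.subset {A Z : Set V} (hA : Linked G A) {x : V} (hxA : x ∈ A) (hxZ : x ∈ Z)
    (hZ : ∀ u ∈ A, u ∈ Z → ∀ v ∈ A, G.Adj u v → v ∈ Z) : A ⊆ Z := fun y hy =>
  mem_of_reachable (G := restrict G A)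
    (fun u hu v huv => hZ u huv.2.1 hu v huv.2.2 huv.1) (hA x hxA y hy) hxZ

theorem linked_of_center {A : Set V} (a : V) (h : ∀ x ∈ A, (restrict G A).Reachable a x) :
    Linked G A := fun x hx y hy => (h x hx).symm.trans (h y hy)

theorem Linked.union {A B : Set V} (hA : Linked G A) (hB : Linked G B)
    (h : (A ∩ B).Nonempty) : Linked G (A ∪ B) := by
  obtain ⟨a, haA, haB⟩ := h
  refine linked_of_center a ?_
  rintro x (hx | hx)
  · exact (hA a haA x hx).mono (restrict_mono Set.subset_union_left)
  · exact (hB a haB x hx).mono (restrict_mono Set.subset_union_right)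

/-- `D 0`, `D 1`, `D 2` are distinct components of `G - H` adjacent to the connected set `H`. -/
structure Branching (G : SimpleGraph V) (H : Set V) (D : Fin 3 → Set V) : Prop where
  nonempty : H.Nonempty
  linked : Linked G H
  disjoint : ∀ k l, k ≠ l → Disjoint (D k) (D l)
  disjoint_left : ∀ k, Disjoint (D k) H
  linked_union : ∀ k, Linked G (D k ∪ H)
  closed : ∀ k, ∀ x ∈ D k, ∀ y, G.Adj x y → y ∈ D k ∪ H

/-- A path avoiding `H` cannot leave a component of `G - H`. All comparisons between branches of
different branching sets rest on this. -/
theorem Branching.subset {H : Set V} {D : Fin 3 → Set V} (hB : Branching G H D) {A : Set V}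
    (hA : Linked G A) (hAH : Disjoint A H) {k : Fin 3} (h : (A ∩ D k).Nonempty) : A ⊆ D k := by
  obtain ⟨x, hxA, hxD⟩ := h
  refine hA.subset hxA hxD fun u _ huD v hv huv => ?_
  exact (hB.closed k u huD v huv).resolve_right fun hvH => Set.disjoint_left.1 hAH hv hvH

/-- A connected set disjoint from `H` lies inside any branch it meets, so it meets at most one of
the three. -/
theorem Branching.exists_two {H H' : Set V} {D : Fin 3 → Set V} (hB : Branching G H D)
    (hH' : Linked G H') (hne : H'.Nonempty) (hd : Disjoint H' H) :
    ∃ k l, k ≠ l ∧ Disjoint (D k) H' ∧ Disjoint (D l) H' := by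
  have key : ∀ k l, k ≠ l → Disjoint (D k) H' ∨ Disjoint (D l) H' := by
    intro k l hkl
    by_contra! hc
    have h1 := hB.subset hH' hd (k := k)
      (by rw [Set.inter_comm]; exact Set.not_disjoint_iff_nonempty_inter.1 hc.1)
    have h2 := hB.subset hH' hd (k := l)
      (by rw [Set.inter_comm]; exact Set.not_disjoint_iff_nonempty_inter.1 hc.2)
    obtain ⟨x, hx⟩ := hne
    exact Set.disjoint_left.1 (hB.disjoint k l hkl) (h1 hx) (h2 hx)
  rcases key 0 1 (by decide) with h0 | h1
  · rcases key 1 2 (by decide) with h1 | h2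
    · exact ⟨0, 1, by decide, h0, h1⟩
    · exact ⟨0, 2, by decide, h0, h2⟩
  · rcases key 0 2 (by decide) with h0 | h2
    · exact ⟨0, 1, by decide, h0, h1⟩
    · exact ⟨1, 2, by decide, h1, h2⟩

/-- Among finitely many disjoint branching sets, one has two branches free of the others. -/
theorem exists_extremal_branching {ι : Type*} (I : Finset ι) (hI : I.Nonempty) (H : ι → Set V)
    (D : ι → Fin 3 → Set V) (hB : ∀ i ∈ I, Branching G (H i) (D i))
    (hd : ∀ i ∈ I, ∀ j ∈ I, i ≠ j → Disjoint (H i) (H j)) :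
    ∃ i ∈ I, ∃ k l, k ≠ l ∧ ∀ j ∈ I, Disjoint (H j) (D i k) ∧ Disjoint (H j) (D i l) := by
  classical
  -- Choose the pair of branches met by the fewest sets. If `H j` met one of them, the two branches
  -- of `j` avoiding `H i` would lie inside that branch and form a pair met by fewer sets, since `H
  -- j` does not meet its own branches.
  let N : ι × Fin 3 × Fin 3 → Finset ι := fun t =>
    I.filter fun j => ¬ Disjoint (H j) (D t.1 t.2.1 ∪ D t.1 t.2.2)
  obtain ⟨⟨i, k, l⟩, hmem, hmin⟩ := Finset.exists_min_image
    (I ×ˢ (Finset.univ.filter fun t : Fin 3 × Fin 3 => t.1 ≠ t.2)) (fun t => (N t).card)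
    (hI.product ⟨(0, 1), by simp⟩)
  simp only [Finset.mem_product, Finset.mem_filter, Finset.mem_univ, true_and] at hmem
  obtain ⟨hi, hkl⟩ := hmem
  have main : ∀ m, (m = k ∨ m = l) → ∀ j ∈ I, Disjoint (H j) (D i m) := by
    intro m hm j hj
    by_contra hc
    have hji : i ≠ j := by
      rintro rfl
      exact hc ((hB i hi).disjoint_left m).symm
    have hne := Set.not_disjoint_iff_nonempty_inter.1 hc
    have hsub := (hB i hi).subset (hB j hj).linked (hd i hi j hj hji).symm hne
    obtain ⟨k', l', hkl', h1, h2⟩ := (hB j hj).exists_two (hB i hi).linked (hB i hi).nonempty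
      (hd i hi j hj hji)
    have hin : ∀ n, Disjoint (D j n) (H i) → D j n ⊆ D i m := by
      intro n hn
      refine Set.subset_union_left.trans ((hB i hi).subset ((hB j hj).linked_union n)
        (hn.union_left (hd i hi j hj hji).symm) ?_)
      obtain ⟨x, hx⟩ := (hB j hj).nonempty
      exact ⟨x, Or.inr hx, hsub hx⟩
    have hm' : D i m ⊆ D i k ∪ D i l := by
      rcases hm with rfl | rfl
      · exact Set.subset_union_left
      · exact Set.subset_union_right
    have hlt : (N (j, k', l')).card < (N (i, k, l)).card := by
      refine Finset.card_lt_card ((Finset.ssubset_iff_of_subset ?_).2 ⟨j, ?_, ?_⟩)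
      · refine Finset.monotone_filter_right I fun a _ ha => ?_
        exact fun hdis => ha (hdis.mono_right
          ((Set.union_subset (hin k' h1) (hin l' h2)).trans hm'))
      · exact Finset.mem_filter.2 ⟨hj, fun hdis => hc (hdis.mono_right hm')⟩
      · intro hmem
        refine (Finset.mem_filter.1 hmem).2 ?_
        exact (((hB j hj).disjoint_left k').union_left ((hB j hj).disjoint_left l')).symm
    exact absurd (hmin (j, k', l') (by simp [hj, hkl'])) (not_le.2 hlt)
  exact ⟨i, hi, k, l, hkl, fun j hj => ⟨main k (Or.inl rfl) j hj, main l (Or.inr rfl) j hj⟩⟩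

/-- The number of disjoint branching sets is at most the size of any set meeting all their
branches. -/
theorem card_branching_le {ι : Type*} (I : Finset ι) (H : ι → Set V)
    (D : ι → Fin 3 → Set V) (hB : ∀ i ∈ I, Branching G (H i) (D i))
    (hd : ∀ i ∈ I, ∀ j ∈ I, i ≠ j → Disjoint (H i) (H j)) (S : Finset V)
    (hS : ∀ i ∈ I, ∀ k, ∃ s ∈ S, s ∈ D i k) : I.card ≤ S.card := by
  classical
  induction hn : I.card generalizing I S with
  | zero => exact Nat.zero_le _
  | succ n ih =>
    -- Discard `i` together with one point `p` of its branch `k`. A branch of another `j` containing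
    -- `p` also contains `q`, because the branches `k` and `l` joined through `H i` form a connected
    -- set avoiding `H j`; so `S` without `p` still meets every remaining branch.
    obtain ⟨i, hi, k, l, hkl, hfree⟩ := exists_extremal_branching I
      (Finset.card_pos.1 (by omega)) H D hB hd
    obtain ⟨p, hpS, hp⟩ := hS i hi k
    obtain ⟨q, hqS, hq⟩ := hS i hi l
    have hpq : q ≠ p := by
      rintro rfl
      exact Set.disjoint_left.1 ((hB i hi).disjoint k l hkl) hp hq
    have hI : ∀ j ∈ I.erase i, j ∈ I := fun j hj => Finset.mem_of_mem_erase hj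
    have h := ih (I.erase i) (fun j hj => hB j (hI j hj))
      (fun a ha b hb => hd a (hI a ha) b (hI b hb)) (S.erase p) ?_
      (by rw [Finset.card_erase_of_mem hi, hn]; rfl)
    · rw [Finset.card_erase_of_mem hpS] at h
      have := Finset.card_pos.2 ⟨p, hpS⟩
      omega
    · intro j hj m
      obtain ⟨s, hsS, hs⟩ := hS j (hI j hj) m
      by_cases hsp : s = p
      · subst hsp
        refine ⟨q, Finset.mem_erase.2 ⟨hpq, hqS⟩, ?_⟩
        have hlink : Linked G ((D i k ∪ H i) ∪ (D i l ∪ H i)) := by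
          refine ((hB i hi).linked_union k).union ((hB i hi).linked_union l) ?_
          obtain ⟨x, hx⟩ := (hB i hi).nonempty
          exact ⟨x, Or.inr hx, Or.inr hx⟩
        have hij := hd i hi j (hI j hj) (Finset.ne_of_mem_erase hj).symm
        have hf := hfree j (hI j hj)
        exact (hB j (hI j hj)).subset hlink
          ((hf.1.symm.union_left hij).union_left (hf.2.symm.union_left hij))
          ⟨s, Or.inl (Or.inl hp), hs⟩ (Or.inr (Or.inl hq))
      · exact ⟨s, Finset.mem_erase.2 ⟨hsp, hsS⟩, hs⟩

/-- `H` is connected in `G`, and at least three infinite components of `G - H` are adjacent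
to it. -/
def IsTrifurcation (G : SimpleGraph V) (H : Set V) : Prop :=
  Linked G H ∧ ∃ d : Fin 3 → V,
    (∀ k, d k ∉ H ∧ (∃ h ∈ H, G.Adj (d k) h) ∧
      {x | (restrict G Hᶜ).Reachable (d k) x}.Infinite) ∧
    ∀ k l, k ≠ l → ¬ (restrict G Hᶜ).Reachable (d k) (d l)

theorem mem_of_reachable_restrict {A : Set V} {x y : V} (hx : x ∈ A)
    (h : (restrict G A).Reachable x y) : y ∈ A :=
  mem_of_reachable (G := restrict G A) (fun _ _ _ huv => huv.2.2) h hx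

theorem linked_component {A : Set V} (d : V) :
    Linked G {x | (restrict G A).Reachable d x} := by
  refine linked_of_center d fun x hx => ?_
  have hx' : (restrict G A).Reachable d x := hx
  refine (mem_of_reachable (G := restrict G A)
    (Z := {x | (restrict G {x | (restrict G A).Reachable d x}).Reachable d x ∧
      (restrict G A).Reachable d x}) ?_ hx' ⟨.refl _, .refl _⟩).1
  rintro u ⟨hu, hu'⟩ v huv
  have hv : (restrict G A).Reachable d v := hu'.trans huv.reachable
  have hadj : (restrict G {x | (restrict G A).Reachable d x}).Adj u v := ⟨huv.1, hu', hv⟩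
  exact ⟨hu.trans hadj.reachable, hv⟩

theorem IsTrifurcation.exists_branching {H : Set V} (h : IsTrifurcation G H) :
    ∃ D : Fin 3 → Set V, Branching G H D ∧ ∀ k, (D k).Infinite := by
  obtain ⟨hH, d, hd, hdis⟩ := h
  refine ⟨fun k => {x | (restrict G Hᶜ).Reachable (d k) x}, ?_, fun k => (hd k).2.2⟩
  refine ⟨?_, hH, ?_, ?_, ?_, ?_⟩
  · obtain ⟨h, hh, _⟩ := (hd 0).2.1
    exact ⟨h, hh⟩
  · intro k l hkl
    refine Set.disjoint_left.2 fun x hx hx' => hdis k l hkl ?_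
    exact SimpleGraph.Reachable.trans hx (SimpleGraph.Reachable.symm hx')
  · intro k
    exact Set.disjoint_left.2 fun x hx hxH => mem_of_reachable_restrict (hd k).1 hx hxH
  · intro k
    obtain ⟨h, hh, hadj⟩ := (hd k).2.1
    set D : Set V := {x | (restrict G Hᶜ).Reachable (d k) x} with hD
    have hdk : d k ∈ D := SimpleGraph.Reachable.refl _
    have hl : Linked G D := linked_component (d k)
    have hstep : (restrict G (D ∪ H)).Adj (d k) h := ⟨hadj, Or.inl hdk, Or.inr hh⟩
    refine linked_of_center (d k) ?_
    rintro x (hx | hx)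
    · exact (hl _ hdk x hx).mono (restrict_mono Set.subset_union_left)
    · exact hstep.reachable.trans ((hH h hh x hx).mono (restrict_mono Set.subset_union_right))
  · intro k x hx y hxy
    by_cases hy : y ∈ H
    · exact Or.inr hy
    · have hxH : x ∉ H := mem_of_reachable_restrict (hd k).1 hx
      have hadj : (restrict G Hᶜ).Adj x y := ⟨hxy, hxH, hy⟩
      exact Or.inl (SimpleGraph.Reachable.trans hx hadj.reachable)

/-- Trifurcations are carried along graph isomorphisms. -/
theorem IsTrifurcation.of_iso {W : Type*} {G' : SimpleGraph W} (φ : G ≃g G') {H : Set V}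
    (h : IsTrifurcation G H) : IsTrifurcation G' (φ '' H) := by
  have hmap : ∀ A x y, (restrict G A).Reachable x y ↔
      (restrict G' (φ '' A)).Reachable (φ x) (φ y) := by
    intro A x y
    let ψ : restrict G A ≃g restrict G' (φ '' A) :=
      { toEquiv := φ.toEquiv
        map_rel_iff' := by
          intro a b
          change (G'.Adj (φ a) (φ b) ∧ φ a ∈ φ '' A ∧ φ b ∈ φ '' A) ↔ _
          rw [φ.map_adj_iff, φ.injective.mem_set_image, φ.injective.mem_set_image]
          rfl }
    exact ψ.reachable_iff.symm
  have hc : (φ '' H)ᶜ = φ '' Hᶜ := (Set.image_compl_eq φ.bijective).symm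
  obtain ⟨hH, d, hd, hdis⟩ := h
  refine ⟨?_, fun k => φ (d k), fun k => ⟨?_, ?_, ?_⟩, fun k l hkl => ?_⟩
  · rintro _ ⟨x, hx, rfl⟩ _ ⟨y, hy, rfl⟩
    exact (hmap H x y).1 (hH x hx y hy)
  · rw [φ.injective.mem_set_image]
    exact (hd k).1
  · obtain ⟨h, hh, hadj⟩ := (hd k).2.1
    exact ⟨φ h, ⟨h, hh, rfl⟩, φ.map_adj_iff.2 hadj⟩
  · rw [hc]
    refine ((hd k).2.2.image φ.injective.injOn).mono ?_
    rintro _ ⟨x, hx, rfl⟩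
    exact (hmap _ _ _).1 hx
  · rw [hc]
    exact fun hr => hdis k l hkl ((hmap _ _ _).2 hr)

/-- If a finite vertex set `L` meets the infinite cluster of `p`, deleting `L` leaves an infinite
piece of the cluster adjacent to `L`. -/
theorem exists_infinite_branch {L : Set V} (hL : L.Finite)
    (hfin : ∀ x, (G.neighborSet x).Finite) {p : V} (hp : p ∈ L)
    (hinf : {x | G.Reachable p x}.Infinite) :
    ∃ d ∉ L, ∃ l ∈ L, G.Adj l d ∧ G.Reachable p l ∧
      {x | (restrict G Lᶜ).Reachable d x}.Infinite := by
  by_contra! hc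
  -- If every piece is finite, the cluster is covered by `L` and one finite piece for each of the
  -- finitely many edges leaving `L`.
  have hfinite : (L ∪ ⋃ l ∈ L, ⋃ d ∈ G.neighborSet l,
      {x | d ∉ L ∧ G.Reachable p l ∧ (restrict G Lᶜ).Reachable d x}).Finite := by
    refine hL.union (hL.biUnion fun l hl => (hfin l).biUnion fun d hd => ?_)
    by_cases h : d ∉ L ∧ G.Reachable p l
    · exact (hc d h.1 l hl hd h.2).subset fun x hx => hx.2.2
    · convert Set.finite_empty
      ext x
      simp only [Set.mem_ofPred_eq, Set.mem_empty_iff_false, iff_false]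
      exact fun hx => h ⟨hx.1, hx.2.1⟩
  refine hinf (hfinite.subset fun x hx => ?_)
  have hx' : G.Reachable p x := hx
  refine (mem_of_reachable (Z := {x | x ∈ _ ∧ G.Reachable p x}) ?_ hx'
    ⟨Or.inl hp, .refl _⟩).1
  rintro u ⟨hu, hpu⟩ v huv
  refine ⟨?_, hpu.trans huv.reachable⟩
  by_cases hv : v ∈ L
  · exact Or.inl hv
  right
  simp only [Set.mem_iUnion, exists_prop]
  by_cases huL : u ∈ L
  · exact ⟨u, huL, v, huv, hv, hpu, .refl _⟩
  · have hu := hu.resolve_left huL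
    simp only [Set.mem_iUnion, exists_prop] at hu
    obtain ⟨l, hl, d, hd, hdL, hpl, hr⟩ := hu
    have hadj : (restrict G Lᶜ).Adj u v := ⟨huv, huL, hv⟩
    exact ⟨l, hl, d, hd, hdL, hpl, SimpleGraph.Reachable.trans hr hadj.reachable⟩

end Graph

/-! ### Invariance of the uniform odd subgraph -/

section Symmetry

/-- The configuration `ω` seen through an automorphism of the square lattice. -/
def pull (φ : squareLattice ≃g squareLattice) (ω : Config) : Config :=
  fun e => ω (φ.mapEdgeSet e)

variable (φ : squareLattice ≃g squareLattice)

/-- The automorphism as an isomorphism of open subgraphs. -/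
def pullIso (ω : Config) : openGraph (pull φ ω) ≃g openGraph ω where
  toEquiv := φ.toEquiv
  map_rel_iff' := by
    intro u v
    constructor
    · rintro ⟨h, hω⟩
      exact ⟨φ.map_adj_iff.1 h, hω⟩
    · rintro ⟨h, hω⟩
      exact ⟨φ.map_adj_iff.2 h, hω⟩

theorem ncard_neighborSet_pull (ω : Config) (v : ℤ × ℤ) :
    ((openGraph (pull φ ω)).neighborSet v).ncard = ((openGraph ω).neighborSet (φ v)).ncard :=
  Nat.card_congr ((pullIso φ ω).mapNeighborSet v)

theorem IsOdd.pull {ω : Config} (h : IsOdd ω) : IsOdd (pull φ ω) := fun v => by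
  rw [ncard_neighborSet_pull]
  exact h _

theorem IsEven.pull {ω : Config} (h : IsEven ω) : IsEven (OddSubgraph.pull φ ω) := fun v => by
  rw [ncard_neighborSet_pull]
  exact h _

theorem measurable_pull : Measurable (pull φ) :=
  measurable_pi_lambda _ fun _ => measurable_pi_apply _

theorem continuous_pull : Continuous (pull φ) :=
  continuous_pi fun _ => continuous_apply _

/-- The action of a lattice automorphism on even subgraphs. -/
def pullEven : evenSubgraphs →+ evenSubgraphs where
  toFun η := ⟨pull φ η, IsEven.pull φ η.2⟩
  map_zero' := rfl
  map_add' _ _ := rfl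

theorem continuous_pullEven : Continuous (pullEven φ) :=
  ((continuous_pull φ).comp continuous_subtype_val).subtype_mk _

theorem pull_symm_pull (ω : Config) : pull φ (pull φ.symm ω) = ω := by
  funext e
  exact congrArg ω (φ.mapEdgeSet.symm_apply_apply e)

/-- A continuous surjective endomorphism of a compact group carries Haar probability measure to a
Haar probability measure, and that measure is unique. -/
theorem map_pullEven : uniformEven.map (pullEven φ) = uniformEven := by
  have : uniformEven.IsAddHaarMeasure := by unfold uniformEven; infer_instance
  have h1 : (uniformEven.map (pullEven φ)).IsAddHaarMeasure :=
    Measure.isAddHaarMeasure_map_of_isFiniteMeasure _ _ (continuous_pullEven φ) fun η =>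
      ⟨⟨pull φ.symm η, IsEven.pull φ.symm η.2⟩, Subtype.ext (pull_symm_pull φ η)⟩
  have h2 : IsProbabilityMeasure (uniformEven.map (pullEven φ)) :=
    Measure.isProbabilityMeasure_map (continuous_pullEven φ).measurable.aemeasurable
  exact Measure.isAddHaarMeasure_eq_of_isProbabilityMeasure _ _

theorem measurable_add_even (ω₀ : Config) :
    Measurable fun η : evenSubgraphs => ω₀ + (η : Config) :=
  (measurable_const_add ω₀).comp measurable_subtype_coe

instance isProbabilityMeasure_uniformOdd (ω₀ : Config) :
    IsProbabilityMeasure (uniformOdd ω₀) :=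
  Measure.isProbabilityMeasure_map (measurable_add_even ω₀).aemeasurable

/-- The uniform odd subgraph is invariant under automorphisms of the square lattice. -/
theorem measurePreserving_pull {ω₀ : Config} (h₀ : IsOdd ω₀) :
    MeasurePreserving (pull φ) (uniformOdd ω₀) (uniformOdd ω₀) := by
  refine ⟨measurable_pull φ, ?_⟩
  -- The image of `ω₀ + η` is `pull φ ω₀ + pull φ η`: another odd reference plus a uniform even
  -- subgraph.
  conv_rhs => rw [uniformOdd_eq h₀ (h₀.pull φ), uniformOdd, ← map_pullEven φ]
  rw [uniformOdd, Measure.map_map (measurable_pull φ) (measurable_add_even _),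
    Measure.map_map (measurable_add_even _) (continuous_pullEven φ).measurable]
  rfl

theorem IsOdd.add {ω η : Config} (hω : IsOdd ω) (hη : IsEven η) : IsOdd (ω + η) := by
  rw [isOdd_iff] at *
  rw [isEven_iff] at hη
  intro v
  simp [val_add, Finset.sum_add_distrib, hω v, hη v]

/-- The uniform odd subgraph is invariant under adding a fixed even subgraph. -/
theorem measurePreserving_add {ω₀ η : Config} (h₀ : IsOdd ω₀) (hη : IsEven η) :
    MeasurePreserving (fun ω => ω + η) (uniformOdd ω₀) (uniformOdd ω₀) := by
  have hm : Measurable fun ω : Config => ω + η := measurable_add_const η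
  refine ⟨hm, ?_⟩
  conv_rhs => rw [uniformOdd_eq h₀ (h₀.add hη), uniformOdd]
  rw [uniformOdd, Measure.map_map hm (measurable_add_even _)]
  congr 1
  funext ω
  exact add_right_comm _ _ _

/-- Translation by `v`. -/
def shift (v : ℤ × ℤ) : squareLattice ≃g squareLattice where
  toEquiv := Equiv.addRight v
  map_rel_iff' := by
    rintro ⟨a, b⟩ ⟨c, d⟩
    obtain ⟨x, y⟩ := v
    simp only [adj_iff_mem_nbrs, nbrs, Finset.mem_insert, Finset.mem_singleton,
      Equiv.coe_addRight, Prod.mk_add_mk, Prod.mk_sub_mk, Prod.mk.injEq]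
    omega

/-- Reflection in the diagonal. -/
def reflect : squareLattice ≃g squareLattice where
  toEquiv := Equiv.prodComm ℤ ℤ
  map_rel_iff' := by
    rintro ⟨a, b⟩ ⟨c, d⟩
    simp only [adj_iff_mem_nbrs, nbrs, Finset.mem_insert, Finset.mem_singleton,
      Equiv.prodComm_apply, Prod.swap_prod_mk, Prod.mk_add_mk, Prod.mk_sub_mk, Prod.mk.injEq]
    omega

theorem shift_apply (v x : ℤ × ℤ) : shift v x = x + v := rfl

theorem reflect_apply (x : ℤ × ℤ) : reflect x = x.swap := rfl

end Symmetry

/-! ### Measurability of the trifurcation event, whose indicator is later integrated -/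

section Measurability

theorem measurableSet_adj (u v : ℤ × ℤ) :
    MeasurableSet {ω : Config | (openGraph ω).Adj u v} := by
  by_cases h : squareLattice.Adj u v
  · have e : {ω : Config | (openGraph ω).Adj u v} =
        (fun ω : Config => ω ⟨s(u, v), h⟩) ⁻¹' {1} := by
      ext ω
      exact ⟨fun hω => hω.2, fun hω => ⟨h, hω⟩⟩
    rw [e]
    exact measurable_pi_apply (X := fun _ : squareLattice.edgeSet => ZMod 2) _
      (measurableSet_singleton 1)
  · convert MeasurableSet.empty
    ext ω
    exact ⟨fun hω => h hω.1, fun hω => hω.elim⟩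

/-- Splitting walks by length and by first step builds the event from single-edge events through
countable unions. -/
theorem measurableSet_reachable (A : Set (ℤ × ℤ)) (u v : ℤ × ℤ) :
    MeasurableSet {ω : Config | (restrict (openGraph ω) A).Reachable u v} := by
  have hn : ∀ (n : ℕ) (u : ℤ × ℤ),
      MeasurableSet {ω : Config | ∃ p : (restrict (openGraph ω) A).Walk u v, p.length = n} := by
    intro n
    induction n with
    | zero =>
      intro u
      by_cases h : u = v
      · subst h
        convert MeasurableSet.univ
        ext ω
        exact ⟨fun _ => trivial, fun _ => ⟨.nil, rfl⟩⟩
      · convert MeasurableSet.empty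
        ext ω
        exact ⟨fun ⟨p, hp⟩ => h (SimpleGraph.Walk.eq_of_length_eq_zero hp), fun hω => hω.elim⟩
    | succ n ih =>
      intro u
      have e : {ω : Config | ∃ p : (restrict (openGraph ω) A).Walk u v, p.length = n + 1} =
          ⋃ w, ({ω : Config | (openGraph ω).Adj u w} ∩ {_ω | u ∈ A ∧ w ∈ A}) ∩
            {ω : Config | ∃ p : (restrict (openGraph ω) A).Walk w v, p.length = n} := by
        ext ω
        simp only [Set.mem_iUnion]
        constructor
        · rintro ⟨p, hp⟩
          cases p with
          | nil => simp at hp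
          | cons h p => exact ⟨_, ⟨h.1, h.2⟩, p, by simpa using hp⟩
        · rintro ⟨w, ⟨h1, h2⟩, p, hp⟩
          exact ⟨.cons ⟨h1, h2⟩ p, congrArg (· + 1) hp⟩
      rw [e]
      exact MeasurableSet.iUnion fun w =>
        ((measurableSet_adj u w).inter (MeasurableSet.const _)).inter (ih w)
  have e : {ω : Config | (restrict (openGraph ω) A).Reachable u v} =
      ⋃ n, {ω : Config | ∃ p : (restrict (openGraph ω) A).Walk u v, p.length = n} := by
    ext ω
    simp only [Set.mem_iUnion]
    exact ⟨fun ⟨p⟩ => ⟨p.length, p, rfl⟩, fun ⟨_, p, _⟩ => ⟨p⟩⟩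
  rw [e]
  exact MeasurableSet.iUnion fun n => hn n u

theorem measurableSet_infinite (A : Set (ℤ × ℤ)) (u : ℤ × ℤ) :
    MeasurableSet {ω : Config | {x | (restrict (openGraph ω) A).Reachable u x}.Infinite} := by
  have e : {ω : Config | {x | (restrict (openGraph ω) A).Reachable u x}.Infinite} =
      ⋂ F : Finset (ℤ × ℤ), ⋃ x : ℤ × ℤ,
        {ω : Config | (restrict (openGraph ω) A).Reachable u x} ∩ {_ω | x ∉ F} := by
    ext ω
    simp only [Set.mem_iInter, Set.mem_iUnion]
    constructor
    · intro h F
      obtain ⟨x, hx, hxF⟩ := Set.Infinite.exists_notMem_finset h F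
      exact ⟨x, hx, hxF⟩
    · intro h hfin
      obtain ⟨x, hx, hxF⟩ := h hfin.toFinset
      exact hxF (hfin.mem_toFinset.2 hx)
  rw [e]
  exact MeasurableSet.iInter fun F => MeasurableSet.iUnion fun x =>
    (measurableSet_reachable A u x).inter (MeasurableSet.const _)

theorem measurableSet_isTrifurcation (H : Set (ℤ × ℤ)) :
    MeasurableSet {ω : Config | IsTrifurcation (openGraph ω) H} := by
  refine MeasurableSet.inter (s₁ := {ω : Config | ∀ x ∈ H, ∀ y ∈ H,
    (restrict (openGraph ω) H).Reachable x y}) (s₂ := {ω : Config | ∃ d : Fin 3 → ℤ × ℤ,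
    (∀ k, d k ∉ H ∧ (∃ h ∈ H, (openGraph ω).Adj (d k) h) ∧
      {x | (restrict (openGraph ω) Hᶜ).Reachable (d k) x}.Infinite) ∧
    ∀ k l, k ≠ l → ¬ (restrict (openGraph ω) Hᶜ).Reachable (d k) (d l)}) ?_ ?_
  · simp only [Set.ofPred_forall]
    exact MeasurableSet.iInter fun x => MeasurableSet.iInter fun _ => MeasurableSet.iInter fun y =>
      MeasurableSet.iInter fun _ => measurableSet_reachable H x y
  · simp only [Set.ofPred_exists, Set.ofPred_and, Set.ofPred_forall]
    refine MeasurableSet.iUnion fun d => MeasurableSet.inter ?_ ?_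
    · exact MeasurableSet.iInter fun k => MeasurableSet.inter (.iInter fun _ => .const _)
        (MeasurableSet.inter (MeasurableSet.iUnion fun h =>
          MeasurableSet.inter (.const _) (measurableSet_adj _ _)) (measurableSet_infinite _ _))
    · exact MeasurableSet.iInter fun k => MeasurableSet.iInter fun l => MeasurableSet.iInter fun _ =>
        (measurableSet_reachable _ _ _).compl

end Measurability

/-! ### Even subgraphs as boundaries of face colourings -/

section Faces

theorem val_comm (ω : Config) (u v : ℤ × ℤ) : val ω u v = val ω v u := by
  have h := (openGraph_adj_iff ω u v).symm.trans
    (((openGraph ω).adj_comm u v).trans (openGraph_adj_iff ω v u))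
  generalize val ω u v = a at *
  generalize val ω v u = b at *
  revert a b
  decide

/-- The value of the boundary of a face colouring at the edge between `u` and `v`: the sum of the
colours of the two faces it separates.  A face is named by its lower left corner. -/
def faceSum (f : ℤ × ℤ → ZMod 2) (u v : ℤ × ℤ) : ZMod 2 :=
  f (min u.1 v.1, min u.2 v.2) +
    if u.2 = v.2 then f (min u.1 v.1, min u.2 v.2 - 1) else f (min u.1 v.1 - 1, min u.2 v.2)

theorem faceSum_comm (f : ℤ × ℤ → ZMod 2) (u v : ℤ × ℤ) : faceSum f u v = faceSum f v u := by
  simp only [faceSum, min_comm u.1, min_comm u.2, eq_comm (a := u.2)]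

/-- The boundary of a face colouring: the edges between faces of different colours. -/
def faceBoundary (f : ℤ × ℤ → ZMod 2) : Config :=
  fun e => Sym2.lift ⟨faceSum f, faceSum_comm f⟩ e.1

theorem val_faceBoundary (f : ℤ × ℤ → ZMod 2) {u v : ℤ × ℤ} (h : squareLattice.Adj u v) :
    val (faceBoundary f) u v = faceSum f u v := by
  rw [val, dif_pos h]
  rfl

theorem val_faceBoundary_right (f : ℤ × ℤ → ZMod 2) (x y : ℤ) :
    val (faceBoundary f) (x, y) (x + 1, y) = f (x, y) + f (x, y - 1) := by
  rw [val_faceBoundary f ((adj_iff_mem_nbrs _ _).2 (by simp [nbrs]))]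
  simp [faceSum]

theorem val_faceBoundary_up (f : ℤ × ℤ → ZMod 2) (x y : ℤ) :
    val (faceBoundary f) (x, y) (x, y + 1) = f (x, y) + f (x - 1, y) := by
  rw [val_faceBoundary f ((adj_iff_mem_nbrs _ _).2 (by simp [nbrs]))]
  simp [faceSum]

theorem sum_nbrs (g : ℤ × ℤ → ZMod 2) (x y : ℤ) :
    ∑ w ∈ nbrs (x, y), g w = g (x + 1, y) + g (x - 1, y) + g (x, y + 1) + g (x, y - 1) := by
  have e : nbrs (x, y) = {(x + 1, y), (x - 1, y), (x, y + 1), (x, y - 1)} := by simp [nbrs]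
  rw [e, Finset.sum_insert, Finset.sum_insert, Finset.sum_insert, Finset.sum_singleton]
  · ring
  all_goals
    simp only [Finset.mem_insert, Finset.mem_singleton, Prod.mk.injEq]
    omega

/-- Each of the four faces around a vertex borders exactly two of the four edges there, so every
colour is counted twice. -/
theorem isEven_faceBoundary (f : ℤ × ℤ → ZMod 2) : IsEven (faceBoundary f) := by
  rw [isEven_iff]
  rintro ⟨x, y⟩
  have h1 := val_faceBoundary_right f (x - 1) y
  have h2 := val_faceBoundary_up f x (y - 1)
  rw [sub_add_cancel] at h1 h2
  rw [sum_nbrs, val_faceBoundary_right, val_faceBoundary_up, val_comm _ _ (x - 1, y), h1,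
    val_comm _ _ (x, y - 1), h2]
  generalize f (x, y) = a
  generalize f (x, y - 1) = b
  generalize f (x - 1, y) = c
  generalize f (x - 1, y - 1) = d
  revert a b c d
  decide

/-- The colouring with the faces of `F` coloured `1` and the others `0`. -/
def faceIndicator (F : Finset (ℤ × ℤ)) (x : ℤ × ℤ) : ZMod 2 := if x ∈ F then 1 else 0

/-- The colouring to be used depends on the configuration; encoding it by a finite set of faces
leaves only countably many toggles. -/
theorem exists_faceIndicator (f : ℤ × ℤ → ZMod 2) (B : Finset (ℤ × ℤ)) (h : ∀ x ∉ B, f x = 0) :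
    ∃ F, f = faceIndicator F := by
  refine ⟨B.filter fun x => f x = 1, funext fun x => ?_⟩
  have key : ∀ a : ZMod 2, a ≠ 1 → a = 0 := by decide
  by_cases hx : f x = 1
  · have hB : x ∈ B := by
      by_contra hc
      rw [h x hc] at hx
      exact absurd hx (by decide)
    simp [faceIndicator, hx, hB]
  · simp [faceIndicator, key _ hx]

end Faces

/-! ### Opening the bracket and creating a trifurcation -/

/-- The rows `0` and `2` of `[0, n] × [0, 2]`, joined by the vertex `(0, 1)`. -/
def bracket (n : ℕ) : Set (ℤ × ℤ) :=
  {x | (0 ≤ x.1 ∧ x.1 ≤ n ∧ (x.2 = 0 ∨ x.2 = 2)) ∨ x = (0, 1)}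

/-- Face colouring that makes the bracket open. -/
noncomputable def bracketFaces (n : ℕ) (ω : Config) (x : ℤ × ℤ) : ZMod 2 :=
  -- Every bracket edge is controlled by its own face: bottom edges by the face above, top edges by
  -- the face below, side edges by the face to the left. The factor in `2 * x.2` sends face rows 0
  -- and 1 to edge heights 0 and 2.
  let g : ℤ × ℤ → ZMod 2 := fun x =>
    if 0 ≤ x.1 ∧ x.1 < n ∧ (x.2 = 0 ∨ x.2 = 1) then
      1 + val ω (x.1, 2 * x.2) (x.1 + 1, 2 * x.2) else 0
  -- A side edge also borders the face `(0, x.2)`; the last summand compensates for its colour.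
  if x.1 = -1 ∧ (x.2 = 0 ∨ x.2 = 1) then 1 + val ω (0, x.2) (0, x.2 + 1) + g (0, x.2) else g x

theorem bracketFaces_eq_zero (n : ℕ) (ω : Config) (x : ℤ × ℤ)
    (h : ¬ (-1 ≤ x.1 ∧ x.1 < n ∧ 0 ≤ x.2 ∧ x.2 ≤ 1)) : bracketFaces n ω x = 0 := by
  have h1 : ¬ (x.1 = -1 ∧ (x.2 = 0 ∨ x.2 = 1)) := by omega
  have h2 : ¬ (0 ≤ x.1 ∧ x.1 < n ∧ (x.2 = 0 ∨ x.2 = 1)) := by omega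
  simp only [bracketFaces, if_neg h1, if_neg h2]

theorem add_one_add_self (a : ZMod 2) : a + (1 + a) = 1 := by
  revert a
  decide

theorem bracket_bottom (n : ℕ) (ω : Config) (x : ℤ) (h0 : 0 ≤ x) (hx : x < n) :
    (openGraph (ω + faceBoundary (bracketFaces n ω))).Adj (x, 0) (x + 1, 0) := by
  rw [openGraph_adj_iff, val_add, val_faceBoundary_right, bracketFaces_eq_zero n ω (x, 0 - 1)
    (by simp)]
  have e : bracketFaces n ω (x, 0) = 1 + val ω (x, 0) (x + 1, 0) :=
    (if_neg (by simp only; omega)).trans (if_pos ⟨h0, hx, Or.inl rfl⟩)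
  rw [e, add_zero, add_one_add_self]

theorem bracket_top (n : ℕ) (ω : Config) (x : ℤ) (h0 : 0 ≤ x) (hx : x < n) :
    (openGraph (ω + faceBoundary (bracketFaces n ω))).Adj (x, 2) (x + 1, 2) := by
  rw [openGraph_adj_iff, val_add, val_faceBoundary_right, bracketFaces_eq_zero n ω (x, 2)
    (by simp)]
  have h1 : ¬ (x = -1 ∧ ((2 - 1 : ℤ) = 0 ∨ (2 - 1 : ℤ) = 1)) := by omega
  have h2 : 0 ≤ x ∧ x < n ∧ ((2 - 1 : ℤ) = 0 ∨ (2 - 1 : ℤ) = 1) := by omega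
  have h3 : (2 * (2 - 1) : ℤ) = 2 := by norm_num
  simp only [bracketFaces, if_neg h1, if_pos h2, h3, zero_add, add_one_add_self]

theorem bracket_side (n : ℕ) (ω : Config) (y : ℤ) (hy : y = 0 ∨ y = 1) :
    (openGraph (ω + faceBoundary (bracketFaces n ω))).Adj (0, y) (0, y + 1) := by
  rw [openGraph_adj_iff, val_add, val_faceBoundary_up]
  have h1 : (0 - 1 : ℤ) = -1 ∧ (y = 0 ∨ y = 1) := ⟨rfl, hy⟩
  have h2 : ¬ ((0 : ℤ) = -1 ∧ (y = 0 ∨ y = 1)) := by omega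
  simp only [bracketFaces, if_pos h1, if_neg h2]
  generalize (if 0 ≤ (0 : ℤ) ∧ (0 : ℤ) < n ∧ (y = 0 ∨ y = 1) then
    1 + val ω (0, 2 * y) (0 + 1, 2 * y) else 0) = a
  generalize val ω (0, y) (0, y + 1) = b
  revert a b
  decide

theorem linked_bracket {G : SimpleGraph (ℤ × ℤ)} (n : ℕ)
    (hb : ∀ x : ℤ, 0 ≤ x → x < n → G.Adj (x, 0) (x + 1, 0))
    (ht : ∀ x : ℤ, 0 ≤ x → x < n → G.Adj (x, 2) (x + 1, 2))
    (h0 : G.Adj (0, 0) (0, 1)) (h1 : G.Adj (0, 1) (0, 2)) : Linked G (bracket n) := by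
  have mem0 : ∀ k : ℕ, k ≤ n → ((k : ℤ), (0 : ℤ)) ∈ bracket n := by
    intro k hk
    simp [bracket, hk]
  have mem2 : ∀ k : ℕ, k ≤ n → ((k : ℤ), (2 : ℤ)) ∈ bracket n := by
    intro k hk
    simp [bracket, hk]
  have mem1 : ((0 : ℤ), (1 : ℤ)) ∈ bracket n := by simp [bracket]
  have m0 : ((0 : ℤ), (0 : ℤ)) ∈ bracket n := mem0 0 (Nat.zero_le _)
  have m2 : ((0 : ℤ), (2 : ℤ)) ∈ bracket n := mem2 0 (Nat.zero_le _)
  have a0 : (restrict G (bracket n)).Adj (0, 1) (0, 0) := ⟨h0.symm, mem1, m0⟩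
  have a2 : (restrict G (bracket n)).Adj (0, 1) (0, 2) := ⟨h1, mem1, m2⟩
  have r0 : ∀ k : ℕ, k ≤ n → (restrict G (bracket n)).Reachable (0, 1) ((k : ℤ), 0) := by
    intro k
    induction k with
    | zero => exact fun _ => a0.reachable
    | succ k ih =>
      intro hk
      have hs : (restrict G (bracket n)).Adj ((k : ℤ), 0) (((k + 1 : ℕ) : ℤ), 0) :=
        ⟨by push_cast; exact hb k (by omega) (by omega), mem0 k (by omega), mem0 _ hk⟩
      exact (ih (by omega)).trans hs.reachable
  have r2 : ∀ k : ℕ, k ≤ n → (restrict G (bracket n)).Reachable (0, 1) ((k : ℤ), 2) := by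
    intro k
    induction k with
    | zero => exact fun _ => a2.reachable
    | succ k ih =>
      intro hk
      have hs : (restrict G (bracket n)).Adj ((k : ℤ), 2) (((k + 1 : ℕ) : ℤ), 2) :=
        ⟨by push_cast; exact ht k (by omega) (by omega), mem2 k (by omega), mem2 _ hk⟩
      exact (ih (by omega)).trans hs.reachable
  refine linked_of_center (0, 1) ?_
  rintro ⟨a, b⟩ (⟨ha, han, hb | hb⟩ | h)
  · obtain ⟨k, rfl⟩ := Int.eq_ofNat_of_zero_le ha
    subst hb
    exact r0 k (by simpa using han)
  · obtain ⟨k, rfl⟩ := Int.eq_ofNat_of_zero_le ha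
    subst hb
    exact r2 k (by simpa using han)
  · rw [h]

/-- The vertices of the strip `[-1, n] × [0, 2]`. -/
noncomputable def strip (n : ℕ) : Finset (ℤ × ℤ) := Finset.Icc (-1) (n : ℤ) ×ˢ Finset.Icc 0 2

theorem mem_strip (n : ℕ) (x : ℤ × ℤ) :
    x ∈ strip n ↔ (-1 ≤ x.1 ∧ x.1 ≤ n) ∧ 0 ≤ x.2 ∧ x.2 ≤ 2 := by
  simp [strip]

/-- All corners of a face with nonzero colour lie in the strip. -/
theorem faceSum_eq_zero_of_notMem_strip (n : ℕ) (ω : Config) {u v : ℤ × ℤ} (hu : u ∉ strip n)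
    (h : squareLattice.Adj u v) : faceSum (bracketFaces n ω) u v = 0 := by
  rw [mem_strip] at hu
  rw [adj_iff_mem_nbrs] at h
  obtain ⟨a, b⟩ := u
  obtain ⟨c, d⟩ := v
  simp only [nbrs, Finset.mem_insert, Finset.mem_singleton, Prod.mk_add_mk, Prod.mk_sub_mk,
    Prod.mk.injEq] at h hu
  unfold faceSum
  split_ifs with he
  all_goals
    simp only at he
    rw [bracketFaces_eq_zero, bracketFaces_eq_zero, add_zero]
    all_goals
      simp only
      omega

/-- Toggling the faces of the strip does not change edges with an endpoint outside of it. -/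
theorem adj_toggle_iff (n : ℕ) (ω : Config) {u v : ℤ × ℤ} (hu : u ∉ strip n) :
    (openGraph (ω + faceBoundary (bracketFaces n ω))).Adj u v ↔ (openGraph ω).Adj u v := by
  rw [openGraph_adj_iff, openGraph_adj_iff, val_add]
  by_cases h : squareLattice.Adj u v
  · rw [val_faceBoundary _ h, faceSum_eq_zero_of_notMem_strip n ω hu h, add_zero]
  · simp [val, h]

theorem openGraph_le (ω : Config) : openGraph ω ≤ squareLattice := fun _ _ h => h.1

theorem finite_neighborSet (ω : Config) (x : ℤ × ℤ) : ((openGraph ω).neighborSet x).Finite :=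
  (nbrs x).finite_toSet.subset fun y hy =>
    Finset.mem_coe.2 ((adj_iff_mem_nbrs x y).1 (openGraph_le ω hy))

/-- The points `p i` lie in distinct infinite clusters. -/
def Spread {ι : Type*} (ω : Config) (p : ι → ℤ × ℤ) : Prop :=
  (∀ i, {x | (openGraph ω).Reachable (p i) x}.Infinite) ∧
    ∀ i j, i ≠ j → ¬ (openGraph ω).Reachable (p i) (p j)

/-- Vertices of the strip with a neighbour outside that are not in the bracket. -/
def stripEnds (n : ℕ) : Finset (ℤ × ℤ) := {(-1, 0), (-1, 1), (-1, 2), ((n : ℤ), 1)}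

/-- Middle vertices `(x, 1)` with `0 < x < n` have all four neighbours in the strip, so they offer
no exit. -/
theorem mem_bracket_or_stripEnds (n : ℕ) {l d : ℤ × ℤ} (hl : l ∈ strip n) (hd : d ∉ strip n)
    (h : squareLattice.Adj l d) : l ∈ bracket n ∨ l ∈ stripEnds n := by
  rw [mem_strip] at hl hd
  rw [adj_iff_mem_nbrs] at h
  obtain ⟨a, b⟩ := l
  obtain ⟨c, d⟩ := d
  simp only [nbrs, Finset.mem_insert, Finset.mem_singleton, Prod.mk_add_mk, Prod.mk_sub_mk,
    Prod.mk.injEq, stripEnds, bracket, Set.mem_ofPred_eq] at *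
  omega

theorem bracket_subset_strip (n : ℕ) : bracket n ⊆ strip n := by
  rintro ⟨a, b⟩ h
  rw [Finset.mem_coe, mem_strip]
  simp only [bracket, Set.mem_ofPred_eq, Prod.mk.injEq] at *
  omega

/-- Distinct clusters need distinct points of `X`, so at most `X.card` of them meet `X`. -/
theorem exists_three {ι : Type*} [Fintype ι] {ω : Config} {p : ι → ℤ × ℤ} (hp : Spread ω p)
    (X : Finset (ℤ × ℤ)) (h : X.card + 3 ≤ Fintype.card ι) :
    ∃ e : Fin 3 → ι, Function.Injective e ∧
      ∀ k, ∀ x ∈ X, ¬ (openGraph ω).Reachable (p (e k)) x := by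
  classical
  let Bad : Finset ι := Finset.univ.filter fun i => ∃ x ∈ X, (openGraph ω).Reachable (p i) x
  have hbad : Bad.card ≤ X.card := by
    have hx : ∀ i : ι, ∃ x, i ∈ Bad → x ∈ X ∧ (openGraph ω).Reachable (p i) x := by
      intro i
      by_cases hi : i ∈ Bad
      · obtain ⟨x, hx⟩ := (Finset.mem_filter.1 hi).2
        exact ⟨x, fun _ => hx⟩
      · exact ⟨(0, 0), fun h => absurd h hi⟩
    choose g hg using hx
    refine Finset.card_le_card_of_injOn g (fun i hi => (hg i hi).1) ?_
    intro i hi j hj hij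
    by_contra hne
    refine hp.2 i j hne ((hg i hi).2.trans ?_)
    rw [hij]
    exact (hg j hj).2.symm
  have hgood : 3 ≤ Badᶜ.card := by
    rw [Finset.card_compl]
    omega
  have hcard : Fintype.card (Fin 3) ≤ Fintype.card {i // i ∈ Badᶜ} := by
    rwa [Fintype.card_fin, Fintype.card_coe]
  obtain ⟨e⟩ := Function.Embedding.nonempty_of_card_le hcard
  refine ⟨fun k => (e k).1, fun k l h => e.injective (Subtype.ext h), fun k x hx hr => ?_⟩
  exact Finset.mem_compl.1 (e k).2 (Finset.mem_filter.2 ⟨Finset.mem_univ _, x, hx, hr⟩)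

/-- If seven infinite clusters meet a row segment, toggling finitely many faces makes the
bracket on that segment a trifurcation. -/
theorem exists_toggle (n : ℕ) {ω : Config} {p : Fin 7 → ℤ × ℤ} (hp : Spread ω p)
    (hrow : ∀ i, (p i).2 = 0 ∧ 0 ≤ (p i).1 ∧ (p i).1 ≤ n) :
    ∃ F : Finset (ℤ × ℤ),
      IsTrifurcation (openGraph (ω + faceBoundary (faceIndicator F))) (bracket n) := by
  obtain ⟨F, hF⟩ := exists_faceIndicator (bracketFaces n ω) (strip n) fun x hx =>
    bracketFaces_eq_zero n ω x fun h => hx ((mem_strip n x).2 (by omega))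
  refine ⟨F, ?_⟩
  rw [← hF]
  set G' := openGraph (ω + faceBoundary (bracketFaces n ω)) with hG'
  -- Seven is chosen as 4 + 3: at most four clusters meet `stripEnds`.
  obtain ⟨e, he, hends⟩ := exists_three hp (stripEnds n)
    ((Nat.add_le_add_right Finset.card_le_four 3).trans (by simp))
  have hbr : ∀ k, ∃ d ∉ (strip n : Set (ℤ × ℤ)), ∃ l ∈ (strip n : Set (ℤ × ℤ)),
      (openGraph ω).Adj l d ∧ (openGraph ω).Reachable (p (e k)) l ∧
      {x | (restrict (openGraph ω) (strip n : Set (ℤ × ℤ))ᶜ).Reachable d x}.Infinite := by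
    intro k
    refine exists_infinite_branch (strip n).finite_toSet (finite_neighborSet ω) ?_ (hp.1 (e k))
    have := hrow (e k)
    rw [Finset.mem_coe, mem_strip]
    omega
  choose d hd l hl hadj hreach hinf using hbr
  have hmem : ∀ k, l k ∈ bracket n := fun k =>
    (mem_bracket_or_stripEnds n (hl k) (hd k) (openGraph_le ω (hadj k))).resolve_right
      fun h => hends k _ h (hreach k)
  have hle : restrict (openGraph ω) (strip n : Set (ℤ × ℤ))ᶜ ≤ restrict G' (bracket n)ᶜ :=
    fun u v h => ⟨(adj_toggle_iff n ω h.2.1).2 h.1,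
      fun hu => h.2.1 (bracket_subset_strip n hu), fun hv => h.2.2 (bracket_subset_strip n hv)⟩
  -- Outside the strip no edge has changed. A path entering the strip would do so at the deleted
  -- bracket or in `stripEnds`, which the cluster avoids; hence the new component stays in the old
  -- cluster.
  have hcluster : ∀ k x, (restrict G' (bracket n)ᶜ).Reachable (d k) x →
      (openGraph ω).Reachable (p (e k)) x := by
    intro k x hx
    refine (mem_of_reachable (G := restrict G' (bracket n)ᶜ)
      (Z := {x | x ∉ strip n ∧ (openGraph ω).Reachable (p (e k)) x}) ?_ hx
      ⟨hd k, (hreach k).trans (hadj k).reachable⟩).2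
    rintro u ⟨hu, hur⟩ v ⟨huv, -, hv⟩
    have huv' : (openGraph ω).Adj u v := (adj_toggle_iff n ω hu).1 huv
    have hvr := hur.trans huv'.reachable
    refine ⟨fun hvs => ?_, hvr⟩
    rcases mem_bracket_or_stripEnds n hvs hu (openGraph_le ω huv'.symm) with h | h
    · exact hv h
    · exact hends k v h hvr
  refine ⟨linked_bracket n (bracket_bottom n ω) (bracket_top n ω)
    (bracket_side n ω 0 (Or.inl rfl)) (bracket_side n ω 1 (Or.inr rfl)), d, ?_, ?_⟩
  · refine fun k => ⟨fun h => hd k (bracket_subset_strip n h), ⟨l k, hmem k, ?_⟩, ?_⟩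
    · exact (adj_toggle_iff n ω (hd k)).2 (hadj k).symm
    · exact (hinf k).mono fun x hx => SimpleGraph.Reachable.mono hle hx
  · intro k m hkm hr
    refine hp.2 (e k) (e m) (fun h => hkm (he h)) ((hcluster k _ hr).trans ?_)
    exact ((hreach m).trans (hadj m).reachable).symm

/-! ### Trifurcations have probability zero -/

section Counting

/-- The boundary of the square `[-1, L + 1]²`. -/
noncomputable def frame (L : ℕ) : Finset (ℤ × ℤ) :=
  ({-1, (L : ℤ) + 1} ×ˢ Finset.Icc (-1) ((L : ℤ) + 1)) ∪
    (Finset.Icc (-1) ((L : ℤ) + 1) ×ˢ {-1, (L : ℤ) + 1})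

theorem card_frame_le (L : ℕ) : (frame L).card ≤ 4 * (L + 3) := by
  have h1 : (Finset.Icc (-1) ((L : ℤ) + 1)).card = L + 3 := by
    rw [Int.card_Icc]
    omega
  have h2 : ({-1, (L : ℤ) + 1} : Finset ℤ).card ≤ 2 := Finset.card_le_two
  refine (Finset.card_union_le _ _).trans ?_
  rw [Finset.card_product, Finset.card_product, h1]
  nlinarith

/-- An infinite connected set that meets the square `[0, L]²` meets its outer boundary. -/
theorem exists_mem_frame (L : ℕ) {G : SimpleGraph (ℤ × ℤ)} (hG : G ≤ squareLattice)
    {A : Set (ℤ × ℤ)} (hA : Linked G A) (hinf : A.Infinite) {x : ℤ × ℤ} (hx : x ∈ A)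
    (hxL : 0 ≤ x.1 ∧ x.1 ≤ L ∧ 0 ≤ x.2 ∧ x.2 ≤ L) : ∃ s ∈ frame L, s ∈ A := by
  by_contra! hc
  refine hinf (((Finset.Icc (0 : ℤ) L ×ˢ Finset.Icc (0 : ℤ) L).finite_toSet).subset
    (hA.subset hx (Finset.mem_coe.2 ?_) ?_))
  · simp only [Finset.mem_product, Finset.mem_Icc]
    omega
  intro u _ huZ v hv huv
  have hvf : v ∉ frame L := fun h => hc v h hv
  have hadj := (adj_iff_mem_nbrs u v).1 (hG huv)
  obtain ⟨a, b⟩ := u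
  obtain ⟨c, d⟩ := v
  simp only [nbrs, frame, Finset.mem_insert, Finset.mem_singleton, Prod.mk_add_mk,
    Prod.mk_sub_mk, Prod.mk.injEq, Finset.mem_union, Finset.mem_product, Finset.mem_Icc,
    Finset.mem_coe] at *
  omega

/-- The corner of the `t`-th translate of the bracket. -/
def corner (n : ℕ) (t : ℕ × ℕ) : ℤ × ℤ := ((t.1 : ℤ) * (n + 2), (t.2 : ℤ) * 3)

theorem disjoint_shift_bracket (n : ℕ) {s t : ℕ × ℕ} (h : s ≠ t) :
    Disjoint (shift (corner n s) '' bracket n) (shift (corner n t) '' bracket n) := by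
  refine Set.disjoint_left.2 ?_
  rintro _ ⟨⟨a, b⟩, hx, rfl⟩ ⟨⟨c, d⟩, hy, hxy⟩
  have hx := (mem_strip n _).1 (bracket_subset_strip n hx)
  have hy := (mem_strip n _).1 (bracket_subset_strip n hy)
  obtain ⟨i, j⟩ := s
  obtain ⟨k, l⟩ := t
  simp only [shift_apply, corner, Prod.mk_add_mk, Prod.mk.injEq] at *
  have hjl : j = l := by omega
  refine h (congrArg₂ _ ?_ hjl)
  -- Both offsets lie in `[-1, n]`, so they differ by less than the spacing `n + 2`.
  have h1 : ((i : ℤ) - k) * (n + 2) = c - a := by linarith [hxy.1]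
  have h2 : ¬ (1 : ℤ) ≤ (i : ℤ) - k := fun hik => by nlinarith
  have h3 : ¬ (i : ℤ) - k ≤ -1 := fun hik => by nlinarith
  omega

open Classical in
/-- At most a boundary-order number of translates of the bracket are trifurcations. -/
theorem card_trifurcation_le (n M : ℕ) (hM : 1 ≤ M) (ω : Config) :
    ((Finset.range M ×ˢ Finset.range M).filter fun t =>
      IsTrifurcation (openGraph (pull (shift (corner n t)) ω)) (bracket n)).card ≤
      4 * (n + 6) * M := by
  set I := (Finset.range M ×ˢ Finset.range M).filter fun t =>
    IsTrifurcation (openGraph (pull (shift (corner n t)) ω)) (bracket n) with hI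
  have hD : ∀ t, ∃ D : Fin 3 → Set (ℤ × ℤ), t ∈ I →
      Branching (openGraph ω) (shift (corner n t) '' bracket n) D ∧ ∀ k, (D k).Infinite := by
    intro t
    by_cases ht : t ∈ I
    · obtain ⟨D, hD⟩ :=
        ((Finset.mem_filter.1 ht).2.of_iso (pullIso (shift (corner n t)) ω)).exists_branching
      exact ⟨D, fun _ => hD⟩
    · exact ⟨fun _ => ∅, fun h => absurd h ht⟩
  choose D hD using hD
  have hcard := card_branching_le I (fun t => shift (corner n t) '' bracket n) D
    (fun t ht => (hD t ht).1) (fun s _ t _ hst => disjoint_shift_bracket n hst)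
    (frame ((n + 3) * M)) ?_
  · refine hcard.trans ((card_frame_le _).trans ?_)
    nlinarith
  · intro t ht k
    obtain ⟨hi, hj⟩ := Finset.mem_product.1 (Finset.mem_filter.1 ht).1
    rw [Finset.mem_range] at hi hj
    have hmem : corner n t ∈ shift (corner n t) '' bracket n :=
      ⟨(0, 0), by simp [bracket], by simp [shift_apply]⟩
    have hbox : ∀ x ∈ shift (corner n t) '' bracket n,
        0 ≤ x.1 ∧ x.1 ≤ (((n + 3) * M : ℕ) : ℤ) ∧ 0 ≤ x.2 ∧
          x.2 ≤ (((n + 3) * M : ℕ) : ℤ) := by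
      rintro _ ⟨⟨a, b⟩, hx, rfl⟩
      have hx' : 0 ≤ a := by
        simp only [bracket, Set.mem_ofPred_eq, Prod.mk.injEq] at hx
        omega
      have hx := (mem_strip n _).1 (bracket_subset_strip n hx)
      obtain ⟨i, j⟩ := t
      simp only [shift_apply, corner, Prod.mk_add_mk] at *
      have hi' : (i : ℤ) + 1 ≤ M := by exact_mod_cast hi
      have hj' : (j : ℤ) + 1 ≤ M := by exact_mod_cast hj
      push_cast
      refine ⟨by positivity, ?_, by omega, ?_⟩
      · nlinarith
      · nlinarith
    obtain ⟨s, hs, hsD⟩ := exists_mem_frame ((n + 3) * M) (openGraph_le ω)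
      ((hD t ht).1.linked_union k) (((hD t ht).2 k).mono Set.subset_union_left)
      (Or.inr hmem) (hbox _ hmem)
    -- The frame is just outside the box containing the brackets, so the point found belongs to the
    -- branch itself.
    refine ⟨s, hs, hsD.resolve_right fun hsH => ?_⟩
    have := hbox s hsH
    simp only [frame, Finset.mem_insert, Finset.mem_singleton, Finset.mem_union,
      Finset.mem_product, Finset.mem_Icc] at hs
    omega

-- Integrating the pointwise bound `4 * (n + 6) * M` over `M ^ 2` equally likely translates and
-- dividing by `M` bounds `M` times the probability uniformly in `M`.
open Classical in
theorem measure_trifurcation_eq_zero {ω₀ : Config} (h₀ : IsOdd ω₀) (n : ℕ) :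
    uniformOdd ω₀ {ω | IsTrifurcation (openGraph ω) (bracket n)} = 0 := by
  set T : Set Config := {ω | IsTrifurcation (openGraph ω) (bracket n)} with hT
  set μ := uniformOdd ω₀ with hμ
  have hTm : MeasurableSet T := measurableSet_isTrifurcation _
  have key : ∀ M : ℕ, 1 ≤ M → (M : ENNReal) * M * μ T ≤ (4 * (n + 6) * M : ℕ) := by
    intro M hM
    have hsum : ∑ t ∈ Finset.range M ×ˢ Finset.range M,
        μ (pull (shift (corner n t)) ⁻¹' T) = (M : ENNReal) * M * μ T := by
      rw [Finset.sum_congr rfl fun t _ =>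
        (measurePreserving_pull (shift (corner n t)) h₀).measure_preimage hTm.nullMeasurableSet]
      simp [hμ]
    have hle : ∀ ω : Config, ∑ t ∈ Finset.range M ×ˢ Finset.range M,
        (pull (shift (corner n t)) ⁻¹' T).indicator (1 : Config → ENNReal) ω ≤
          (4 * (n + 6) * M : ℕ) := by
      intro ω
      refine le_trans (le_of_eq ?_) (Nat.cast_le.2 (card_trifurcation_le n M hM ω))
      rw [Finset.card_filter, Nat.cast_sum]
      refine Finset.sum_congr rfl fun t _ => ?_
      simp [Set.indicator_apply, hT]
    calc (M : ENNReal) * M * μ T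
        = ∑ t ∈ Finset.range M ×ˢ Finset.range M,
          ∫⁻ ω, (pull (shift (corner n t)) ⁻¹' T).indicator 1 ω ∂μ := by
          rw [← hsum]
          exact Finset.sum_congr rfl fun t _ =>
            (lintegral_indicator_one (measurable_pull _ hTm)).symm
      _ = ∫⁻ ω, ∑ t ∈ Finset.range M ×ˢ Finset.range M,
          (pull (shift (corner n t)) ⁻¹' T).indicator 1 ω ∂μ :=
          (lintegral_finsetSum _ fun t _ =>
            measurable_one.indicator (measurable_pull _ hTm)).symm
      _ ≤ ∫⁻ _, ((4 * (n + 6) * M : ℕ) : ENNReal) ∂μ := lintegral_mono hle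
      _ = (4 * (n + 6) * M : ℕ) := by simp [μ]
  have hfin : μ T ≠ ⊤ := measure_ne_top _ _
  have hreal : ∀ M : ℕ, 1 ≤ M → (M : ℝ) * (μ T).toReal ≤ 4 * (n + 6) := by
    intro M hM
    have h := ENNReal.toReal_mono (ENNReal.natCast_ne_top _) (key M hM)
    rw [ENNReal.toReal_mul, ENNReal.toReal_mul, ENNReal.toReal_natCast,
      ENNReal.toReal_natCast] at h
    push_cast at h
    have hM0 : (0 : ℝ) < M := by exact_mod_cast hM
    nlinarith
  by_contra hne
  have hpos : 0 < (μ T).toReal := ENNReal.toReal_pos hne hfin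
  obtain ⟨M, hM⟩ := exists_nat_gt ((4 * (n + 6) : ℝ) / (μ T).toReal)
  have hM1 : 1 ≤ M := by
    have : (0 : ℝ) < M := lt_of_le_of_lt (by positivity) hM
    exact_mod_cast this
  rw [div_lt_iff₀ hpos] at hM
  exact absurd (hreal M hM1) (not_le.2 hM)

end Counting

/-! ### From infinitely many infinite clusters to a crowded line -/

section Rows

theorem Spread.pull {ι : Type*} (φ : squareLattice ≃g squareLattice) {ω : Config}
    {p q : ι → ℤ × ℤ} (hp : Spread ω p) (hq : ∀ i, φ (q i) = p i) : Spread (pull φ ω) q := by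
  have hr : ∀ x y, (openGraph (OddSubgraph.pull φ ω)).Reachable x y ↔
      (openGraph ω).Reachable (φ x) (φ y) := fun x y => (pullIso φ ω).reachable_iff.symm
  refine ⟨fun i => ?_, fun i j hij h => hp.2 i j hij ?_⟩
  · refine Set.Infinite.of_image φ ((hp.1 i).mono fun x hx => ⟨φ.symm x, ?_, φ.apply_symm_apply x⟩)
    rw [Set.mem_ofPred_eq, hr, hq, φ.apply_symm_apply]
    exact hx
  · rw [← hq, ← hq]
    exact (hr _ _).1 h

/-- Almost surely, no finite row segment meets seven infinite clusters. -/
theorem measure_segment_eq_zero {ω₀ : Config} (h₀ : IsOdd ω₀) (n : ℕ) :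
    uniformOdd ω₀ {ω | ∃ p : Fin 7 → ℤ × ℤ, Spread ω p ∧
      ∀ i, (p i).2 = 0 ∧ 0 ≤ (p i).1 ∧ (p i).1 ≤ n} = 0 := by
  -- A countable union of null preimages covers the event, whose own measurability is therefore not
  -- needed.
  refine measure_mono_null (t := ⋃ F : Finset (ℤ × ℤ),
    (fun ω => ω + faceBoundary (faceIndicator F)) ⁻¹'
      {ω | IsTrifurcation (openGraph ω) (bracket n)}) ?_ ?_
  · rintro ω ⟨p, hp, hrow⟩
    obtain ⟨F, hF⟩ := exists_toggle n hp hrow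
    exact Set.mem_iUnion.2 ⟨F, hF⟩
  · exact measure_iUnion_null fun F =>
      (measurePreserving_add h₀ (isEven_faceBoundary _)).quasiMeasurePreserving.preimage_null
        (measure_trifurcation_eq_zero h₀ n)

/-- Almost surely, no row meets seven infinite clusters. -/
theorem measure_row_eq_zero {ω₀ : Config} (h₀ : IsOdd ω₀) :
    uniformOdd ω₀ {ω | ∃ p : Fin 7 → ℤ × ℤ, Spread ω p ∧ ∃ y, ∀ i, (p i).2 = y} = 0 := by
  refine measure_mono_null (t := ⋃ t : (ℤ × ℤ) × ℕ, pull (shift t.1) ⁻¹'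
    {ω | ∃ p : Fin 7 → ℤ × ℤ, Spread ω p ∧
      ∀ i, (p i).2 = 0 ∧ 0 ≤ (p i).1 ∧ (p i).1 ≤ t.2}) ?_ ?_
  · rintro ω ⟨p, hp, y, hy⟩
    obtain ⟨n, hn⟩ : ∃ n : ℕ, ∀ i, (p i).1.natAbs ≤ n :=
      ⟨Finset.univ.sup fun i => (p i).1.natAbs, fun i =>
        Finset.le_sup (f := fun i => (p i).1.natAbs) (Finset.mem_univ i)⟩
    refine Set.mem_iUnion.2 ⟨((-(n : ℤ), y), 2 * n), fun i => p i - (-(n : ℤ), y),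
      hp.pull _ fun i => by rw [shift_apply, sub_add_cancel], fun i => ?_⟩
    have h1 := hn i
    have h2 := hy i
    simp only [Prod.snd_sub, Prod.fst_sub]
    push_cast
    omega
  · exact measure_iUnion_null fun t =>
      (measurePreserving_pull (shift t.1) h₀).quasiMeasurePreserving.preimage_null
        (measure_segment_eq_zero h₀ t.2)

/-- An infinite cluster meeting a square meets one of four lines around it. -/
theorem exists_mem_line {G : SimpleGraph (ℤ × ℤ)} (hG : G ≤ squareLattice) (n : ℕ) {x : ℤ × ℤ}
    (hx : x.1.natAbs ≤ n ∧ x.2.natAbs ≤ n) (hinf : {y | G.Reachable x y}.Infinite) :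
    ∃ (y : ℤ × ℤ) (b : Bool × Bool), G.Reachable x y ∧
      (if b.1 then y.1 else y.2) = if b.2 then (n : ℤ) + 1 else -(n : ℤ) - 1 := by
  by_contra! hc
  refine hinf (((Finset.Icc (-(n : ℤ)) n ×ˢ Finset.Icc (-(n : ℤ)) n).finite_toSet).subset ?_)
  intro y hy
  -- A lattice step out of the square lands on one of the four lines, which the cluster is assumed
  -- to avoid.
  have hsq : ∀ y ∈ {y | (y.1.natAbs ≤ n ∧ y.2.natAbs ≤ n) ∧ G.Reachable x y},
      ∀ v, G.Adj y v → v ∈ {y | (y.1.natAbs ≤ n ∧ y.2.natAbs ≤ n) ∧ G.Reachable x y} := by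
    rintro u ⟨hu, hur⟩ v huv
    have hvr := hur.trans huv.reachable
    refine ⟨?_, hvr⟩
    have h1 := hc v (true, true) hvr
    have h2 := hc v (true, false) hvr
    have h3 := hc v (false, true) hvr
    have h4 := hc v (false, false) hvr
    have hadj := (adj_iff_mem_nbrs u v).1 (hG huv)
    obtain ⟨a, b⟩ := u
    obtain ⟨c, d⟩ := v
    simp only [nbrs, Finset.mem_insert, Finset.mem_singleton, Prod.mk_add_mk, Prod.mk_sub_mk,
      Prod.mk.injEq, if_true, Bool.false_eq_true, if_false, ne_eq] at *
    omega
  have h := (mem_of_reachable hsq hy ⟨hx, .refl _⟩).1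
  simp only [Finset.mem_coe, Finset.mem_product, Finset.mem_Icc]
  omega

/-- If there are infinitely many infinite clusters, some row or some column meets seven. -/
theorem exists_crowded_line {ω : Config} (h : (infiniteClusters ω).Infinite) :
    ∃ p : Fin 7 → ℤ × ℤ, Spread ω p ∧
      ((∃ y, ∀ i, (p i).2 = y) ∨ ∃ x, ∀ i, (p i).1 = x) := by
  classical
  -- Since 25 > 4 · 6, pigeonhole over four lines puts at least seven clusters on one of them.
  obtain ⟨c⟩ : Nonempty (Fin 25 ↪ infiniteClusters ω) := by
    have := h.to_subtype
    exact ⟨Fin.valEmbedding.trans (Infinite.natEmbedding _)⟩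
  have hrep : ∀ i, ∃ x, (openGraph ω).connectedComponentMk x = (c i).1 :=
    fun i => (c i).1.exists_rep
  choose x hx using hrep
  have hinf : ∀ i, {y | (openGraph ω).Reachable (x i) y}.Infinite := by
    intro i
    refine Set.Infinite.mono ?_ (c i).2
    intro y hy
    rw [SimpleGraph.ConnectedComponent.mem_supp_iff, ← hx i] at hy
    exact (SimpleGraph.ConnectedComponent.exact hy).symm
  have hne : ∀ i j, i ≠ j → ¬ (openGraph ω).Reachable (x i) (x j) := by
    intro i j hij hr
    refine hij (c.injective (Subtype.ext ?_))
    rw [← hx i, ← hx j]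
    exact SimpleGraph.ConnectedComponent.sound hr
  obtain ⟨n, hn⟩ : ∃ n : ℕ, ∀ i, max (x i).1.natAbs (x i).2.natAbs ≤ n :=
    ⟨Finset.univ.sup fun i => max (x i).1.natAbs (x i).2.natAbs, fun i =>
      Finset.le_sup (f := fun i => max (x i).1.natAbs (x i).2.natAbs) (Finset.mem_univ i)⟩
  choose y b hy hb using fun i => exists_mem_line (openGraph_le ω) n (max_le_iff.1 (hn i)) (hinf i)
  obtain ⟨β, hβ⟩ := Fintype.exists_lt_card_fiber_of_mul_lt_card (n := 6) b (by simp)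
  obtain ⟨e⟩ : Nonempty (Fin 7 ↪ {i // i ∈ Finset.univ.filter fun i => b i = β}) :=
    Function.Embedding.nonempty_of_card_le (by rw [Fintype.card_fin, Fintype.card_coe]; exact hβ)
  have he : ∀ k, b (e k).1 = β := fun k => (Finset.mem_filter.1 (e k).2).2
  refine ⟨fun k => y (e k).1, ⟨fun k => ?_, fun k l hkl hr => ?_⟩, ?_⟩
  · exact (hinf (e k).1).mono fun z hz => (hy (e k).1).symm.trans hz
  · exact hne (e k).1 (e l).1 (fun h => hkl (e.injective (Subtype.ext h)))
      ((hy _).trans (hr.trans (hy _).symm))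
  · have hb' : ∀ k, _ := fun k => hb (e k).1
    simp only [he] at hb'
    rcases β with ⟨_ | _, s⟩
    · exact Or.inl ⟨_, fun k => by simpa using hb' k⟩
    · exact Or.inr ⟨_, fun k => by simpa using hb' k⟩

end Rows

end OddSubgraph

theorem lemma4p1 (ω₀ : OddSubgraph.Config) (hω₀ : OddSubgraph.IsOdd ω₀) :
    ∀ᵐ ω ∂(OddSubgraph.uniformOdd ω₀), (OddSubgraph.infiniteClusters ω).Finite := by
  rw [ae_iff]
  have hrow := OddSubgraph.measure_row_eq_zero hω₀
  -- Reflection in the diagonal turns a crowded column into a crowded row.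
  refine measure_mono_null ?_ (measure_union_null hrow
    ((OddSubgraph.measurePreserving_pull OddSubgraph.reflect
      hω₀).quasiMeasurePreserving.preimage_null hrow))
  intro ω hω
  obtain ⟨p, hp, h | ⟨x, hx⟩⟩ := OddSubgraph.exists_crowded_line hω
  · exact Or.inl ⟨p, hp, h⟩
  · exact Or.inr ⟨fun i => (p i).swap, hp.pull _ fun i => by
      rw [OddSubgraph.reflect_apply, Prod.swap_swap], x, hx⟩
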